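/- Let $M$ be a self-adjoint (possibly unbounded) operator with dense domain $\mathrm{Dom}\,M$ in a complex Hilbert space $\mathcal H$, and let $\lambda\in\mathrm{Spec}_{\mathrm{disc}}M$, i.e. $\lambda$ is an eigenvalue of $M$ of finite multiplicity which is an isolated point of $\mathrm{Spec}\,M$. Assume $\mathrm{Spec}\,M\neq\{\lambda\}$ and put $\mu:=\mathrm{dist}[\lambda,\mathrm{Spec}\,M\setminus\{\lambda\}]>0$. For each $n$ let $\Pi_n$ be the orthogonal projection of $\mathcal H$ onto a finite-dimensional subspace $\mathcal L_n\subset\mathrm{Dom}\,M^2$, and assume that $$\lim_{n\to\infty}\|\Pi_nM^k\Pi_n\psi-\lambda^k\psi\|=0\qquad (k=0,1,2)\quad\text{whenever } M\psi=\lambda\psi .$$ Let $M_n:=\Pi_nM|_{\mathcal L_n}$, $[M^2]_n:=\Pi_nM^2|_{\mathcal L_n}$ and $$P_n(z):=\Pi_n(z-M)^2|_{\mathcal L_n}=z^2-2M_nz+[M^2]_n .$$ For a polynomial $P(z)$ with coefficients linear operators on a finite-dimensional space, let $\mathrm{Spec}\,P:=\{z\in\mathbb C:\det P(z)=0\}$;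 its points are the eigenvalues of $P$, and the multiplicity of an eigenvalue is its order as a zero of $\det P(z)$. Let $w_0,w_1\ge 0$ not both be zero and let $0<\delta<\mu/4$. Then there is $N>0$ (depending on $M$, $\lambda$, $(\Pi_n)$, $\delta$, $w_0$, $w_1$, but not on $\varepsilon$ or on the perturbation) such that, for every $\varepsilon$ with $$0\le\varepsilon<\frac{\delta^2\mu^2}{2(2\delta^2+3\mu^2)\,[\,w_0+w_1(\mu/4+|\lambda|)\,]}$$ and for every sequence $Q_n(z)=F_nz-G_n$, where $F_n,G_n$ are linear operators on $\mathcal L_n$ whose operator norms satisfy $\|G_n\|\le w_0\varepsilon$ and $\|F_n\|\le w_1\varepsilon$, the following hold for all $n>N$: 1. $\mathrm{Spec}(P_n+Q_n)\cap\{\delta\le|z-\lambda|\le\mu/4\}=\varnothing$; 2. $\mathrm{Spec}(P_n+Q_n)\cap\{|z-\lambda|<\delta\}\neq\varnothing$; 3. counted with multiplicity, $P_n$ and $P_n+Q_n$ have the same number of eigenvalues in $\{|z-\lambda|<\delta\}$. -/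

import Mathlib

open Filter Topology Polynomial

noncomputable section

namespace SecondOrderProjection

variable {H : Type*} [NormedAddCommGroup H] [InnerProductSpace ℂ H]

/-- The resolvent set of an operator `M` with domain `M.domain`: those `z` for which
`z - M : Dom M → H` has an everywhere defined bounded two-sided inverse `R`. -/
def resolventSet (M : H →ₗ.[ℂ] H) : Set ℂ :=
  {z | ∃ R : H →L[ℂ] H,
    (∀ x : M.domain, R (z • (x : H) - M x) = x) ∧
    (∀ y : H, ∃ x : M.domain, (x : H) = R y ∧ z • (x : H) - M x = y)}

/-- The spectrum of an (in general unbounded) operator. -/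
def Spec (M : H →ₗ.[ℂ] H) : Set ℂ := (resolventSet M)ᶜ

/-- `{ψ ∈ Dom M : M ψ = lam ψ}` as a subspace of `H`. -/
def eigenspace (M : H →ₗ.[ℂ] H) (lam : ℂ) : Submodule ℂ H :=
  (LinearMap.ker (M.toFun - lam • M.domain.subtype)).map M.domain.subtype

/-- The discrete spectrum: eigenvalues of finite multiplicity which are isolated points of the
spectrum. -/
def SpecDisc (M : H →ₗ.[ℂ] H) : Set ℂ :=
  {lam | lam ∈ Spec M ∧ (∀ᶠ z in 𝓝[≠] lam, z ∉ Spec M) ∧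
    eigenspace M lam ≠ ⊥ ∧ FiniteDimensional ℂ (eigenspace M lam)}

/-- The distance from `lam` to the rest of the spectrum. (If there is no rest of the spectrum,
this is `0`, and then there is no `d` with `0 < d < spectralGap M lam / 4`.) -/
def spectralGap (M : H →ₗ.[ℂ] H) (lam : ℂ) : ℝ := Metric.infDist lam (Spec M \ {lam})

/-- The operator `M²` with its natural domain `{x ∈ Dom M : M x ∈ Dom M}`. -/
def sq (M : H →ₗ.[ℂ] H) : H →ₗ.[ℂ] H where
  domain :=
    { carrier := {x | ∃ h : x ∈ M.domain, M ⟨x, h⟩ ∈ M.domain}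
      zero_mem' := ⟨M.domain.zero_mem, by
        have h : M ⟨0, M.domain.zero_mem⟩ = 0 := M.map_zero
        rw [h]; exact M.domain.zero_mem⟩
      add_mem' := by
        rintro x y ⟨hx, hx'⟩ ⟨hy, hy'⟩
        refine ⟨M.domain.add_mem hx hy, ?_⟩
        have h : M ⟨x + y, M.domain.add_mem hx hy⟩ = M ⟨x, hx⟩ + M ⟨y, hy⟩ :=
          M.map_add ⟨x, hx⟩ ⟨y, hy⟩
        rw [h]; exact M.domain.add_mem hx' hy'
      smul_mem' := by
        rintro c x ⟨hx, hx'⟩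
        refine ⟨M.domain.smul_mem c hx, ?_⟩
        have h : M ⟨c • x, M.domain.smul_mem c hx⟩ = c • M ⟨x, hx⟩ := M.map_smul c ⟨x, hx⟩
        rw [h]; exact M.domain.smul_mem c hx' }
  toFun :=
    { toFun := fun x => M ⟨M ⟨x, x.2.1⟩, x.2.2⟩
      map_add' := by
        intro x y
        rw [← M.map_add]
        congr 1
        exact Subtype.ext (M.map_add ⟨x, x.2.1⟩ ⟨y, y.2.1⟩)
      map_smul' := by
        intro c x
        rw [RingHom.id_apply, ← M.map_smul]
        congr 1
        exact Subtype.ext (M.map_smul c ⟨x, x.2.1⟩) }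

theorem le_domain_of_le_sq_domain {M : H →ₗ.[ℂ] H} {L : Submodule ℂ H}
    (h : L ≤ (sq M).domain) : L ≤ M.domain :=
  fun _ hx => (h hx).1

/-- The compression `Π T|_L` of an operator `T` to a finite-dimensional subspace `L ⊆ Dom T`,
where `Π` is the orthogonal projection onto `L`. -/
def compression (T : H →ₗ.[ℂ] H) (L : Submodule ℂ H) [FiniteDimensional ℂ L]
    (h : L ≤ T.domain) : L →L[ℂ] L :=
  LinearMap.toContinuousLinearMap
    ((L.orthogonalProjectionOnto : H →ₗ[ℂ] L) ∘ₗ T.toFun ∘ₗ Submodule.inclusion h)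

/-- The approximation condition: `‖Π_n M^k Π_n ψ - lam^k ψ‖ → 0` for `k = 0, 1, 2` and every
`ψ` with `M ψ = lam ψ`, where `Π_n` is the orthogonal projection onto `L n ⊆ Dom M²`. -/
def ApproximatesEigenvectors (M : H →ₗ.[ℂ] H) (lam : ℂ) (L : ℕ → Submodule ℂ H)
    [∀ n, FiniteDimensional ℂ (L n)] (hL : ∀ n, L n ≤ (sq M).domain) : Prop :=
  ∀ ψ ∈ eigenspace M lam,
    Tendsto (fun n => ‖((L n).orthogonalProjectionOnto ψ : H) - ψ‖) atTop (𝓝 0) ∧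
    Tendsto (fun n => ‖(compression M (L n) (le_domain_of_le_sq_domain (hL n))
      ((L n).orthogonalProjectionOnto ψ) : H) - lam • ψ‖) atTop (𝓝 0) ∧
    Tendsto (fun n => ‖(compression (sq M) (L n) (hL n)
      ((L n).orthogonalProjectionOnto ψ) : H) - lam ^ 2 • ψ‖) atTop (𝓝 0)

section OperatorPolynomials

variable {L : Type*} [NormedAddCommGroup L] [NormedSpace ℂ L]

/-- The value `P(z) = ∑ A_k z^k` of a polynomial with operator coefficients. -/
def evalAt (P : (L →L[ℂ] L)[X]) (z : ℂ) : L →L[ℂ] L := P.eval (algebraMap ℂ (L →L[ℂ] L) z)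

/-- The spectrum `{z : det P(z) = 0}` of a polynomial with operator coefficients on a
finite-dimensional space. -/
def polySpec (P : (L →L[ℂ] L)[X]) : Set ℂ := {z | (evalAt P z).det = 0}

/-- The ring homomorphism sending an operator to its matrix in some basis. -/
def toMatrixHom (L : Type*) [NormedAddCommGroup L] [NormedSpace ℂ L] [FiniteDimensional ℂ L] :
    (L →L[ℂ] L) →+* Matrix (Fin (Module.finrank ℂ L)) (Fin (Module.finrank ℂ L)) ℂ :=
  ((LinearMap.toMatrixAlgEquiv (Module.finBasis ℂ L)).toRingEquiv : _ →+* _).comp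
    (ContinuousLinearMap.toLinearMapRingHom : (L →L[ℂ] L) →+* (L →ₗ[ℂ] L))

/-- The scalar polynomial `det P(z)`; `eval_detPoly` shows that it has the right values, so that
it does not depend on the basis. -/
def detPoly [FiniteDimensional ℂ L] (P : (L →L[ℂ] L)[X]) : ℂ[X] :=
  (matPolyEquiv.symm (P.map (toMatrixHom L))).det

theorem eval_detPoly [FiniteDimensional ℂ L] (P : (L →L[ℂ] L)[X]) (z : ℂ) :
    (detPoly P).eval z = (evalAt P z).det := by
  have h : Matrix.scalar _ z = toMatrixHom L (algebraMap ℂ (L →L[ℂ] L) z) := by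
    have h2 : (ContinuousLinearMap.toLinearMapRingHom (algebraMap ℂ (L →L[ℂ] L) z)
        : L →ₗ[ℂ] L) = algebraMap ℂ (L →ₗ[ℂ] L) z := rfl
    simp only [toMatrixHom, RingHom.comp_apply, h2]
    exact ((LinearMap.toMatrixAlgEquiv (Module.finBasis ℂ L)).commutes z).symm
  rw [detPoly, eval_det, AlgEquiv.apply_symm_apply, h, Polynomial.eval_map_apply]
  exact LinearMap.det_toMatrix (Module.finBasis ℂ L) _

/-- The number of eigenvalues of `P` in `S`, counted with multiplicity, the multiplicity of an
eigenvalue being its order as a zero of the polynomial `det P(z)`. -/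
def eigenvalueCount [FiniteDimensional ℂ L] (P : (L →L[ℂ] L)[X]) (S : Set ℂ) : ℕ :=
  open Classical in (detPoly P).roots.countP (fun z => z ∈ S)

end OperatorPolynomials

/-- The quadratic polynomial `P_n(z) = Π_n (z - M)²|_L = z² - 2 M_n z + [M²]_n`. -/
def quadPoly (M : H →ₗ.[ℂ] H) (L : Submodule ℂ H) [FiniteDimensional ℂ L]
    (hL : L ≤ (sq M).domain) : (L →L[ℂ] L)[X] :=
  X ^ 2 - C (2 * compression M L (le_domain_of_le_sq_domain hL)) * X + C (compression (sq M) L hL)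

/-- The sequences of linear operator polynomials `Q_n(z) = F_n z - G_n` on the spaces `L n` with
`‖G_n‖ ≤ w₀ ε` and `‖F_n‖ ≤ w₁ ε` in the operator norm. -/
def perturbations (L : ℕ → Submodule ℂ H) (ε w₀ w₁ : ℝ) : Set (∀ n, (L n →L[ℂ] L n)[X]) :=
  {Q | ∃ F G : ∀ n, L n →L[ℂ] L n,
    ∀ n, Q n = C (F n) * X - C (G n) ∧ ‖G n‖ ≤ w₀ * ε ∧ ‖F n‖ ≤ w₁ * ε}

end SecondOrderProjection

end

/-!
Everything rests on a lower bound for `P_n(z)` on the annulus `δ ≤ |z - lam| ≤ μ / 4`, uniform in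
`n` and `z`.

Let `E` be the eigenspace of `lam`. If `s` is a real point of the resolvent set close to `lam`, the
bounded self-adjoint operator `(s - M)⁻¹` has the isolated spectral point `(s - lam)⁻¹`, and the
continuous functional calculus bounds its norm on `Eᗮ` by the rest of its spectrum. As `s → lam`
this gives `‖(M - lam) u‖ ≥ μ ‖u‖` for `u ∈ Dom M ∩ Eᗮ` (`spectralGap_mul_norm_le`).

The operator `P_n(z)` represents the form `⟪(z̄ - M) v, (z - M) u⟫` on `L_n`. This form is diagonal
for `E ⊕ Eᗮ`: on `E` it is `(z - lam)² ⟪v, u⟫`, and on `Eᗮ` its real part is at least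
`|z - lam|² ‖u‖²` on the diagonal. Multiplying the `E`-component of the test vector `v = u` by a
suitable phase therefore makes the real part at least `δ² ‖u‖²`. That test vector need not lie in
`L_n`, but replacing an eigenvector `ψ` by `Π_n ψ` costs only `‖P_n(z̄) Π_n ψ - (z̄ - lam)² ψ‖`,
which the approximation condition makes uniformly small as `E` is finite-dimensional. The result is
`‖P_n(z) u‖ ≥ δ² / 6 ‖u‖` for large `n` (`evalAt_quadPoly_lower_bound`).

The bound on `ε` implies `‖Q_n(z)‖ < δ² / 6` on the annulus, so no `P_n + t Q_n` with `0 ≤ t ≤ 1` is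
singular there; by the argument principle the number of eigenvalues in the disc does not depend on
`t` (`eigenvalueCount_add_eq`). This number is positive: `P_n(lam) Π_n ψ` is small, so if `P_n` had
no eigenvalue in the disc, then `z ↦ P_n(z)⁻¹ P_n(lam) Π_n ψ` would violate the maximum modulus
principle (`polySpec_inter_ball_nonempty`).
-/

namespace SecondOrderProjection

variable {H : Type*} [NormedAddCommGroup H] [InnerProductSpace ℂ H]

/-! ### The spectral gap estimate -/

/-- A bounded self-adjoint operator whose spectrum is `{c}` together with a part in `[-r, r]`,
`r < |c|`, has norm at most `r` on the orthogonal complement of its `c`-eigenspace: the isolated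
point `c` of the spectrum is cut off by a continuous function, and the corresponding spectral
projection takes its values in the eigenspace. -/
theorem norm_apply_le_of_orthogonal_eigenspace [CompleteSpace H] {R : H →L[ℂ] H}
    (hR : IsSelfAdjoint R) {c r : ℝ} (hr : 0 ≤ r) (hrc : r < |c|)
    (hspec : ∀ t ∈ spectrum ℝ R, t = c ∨ |t| ≤ r) {w : H}
    (hw : ∀ ψ : H, R ψ = (c : ℂ) • ψ → inner ℂ ψ w = 0) : ‖R w‖ ≤ r * ‖w‖ := by
  have hcr : 0 < |c| - r := sub_pos.2 hrc
  -- A continuous function equal to `1` at `c` and to `0` on the rest of the spectrum.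
  set g : ℝ → ℝ := fun t => max 0 ((|t| - r) / (|c| - r)) with hg
  have gc : Continuous g := by fun_prop
  have g1 : g c = 1 := by simp [hg, div_self hcr.ne']
  have g0 : ∀ t, |t| ≤ r → g t = 0 := fun t ht =>
    max_eq_left (div_nonpos_of_nonpos_of_nonneg (by linarith) hcr.le)
  set p : H →L[ℂ] H := cfc g R with hp
  have hpsa : IsSelfAdjoint p := cfc_predicate g R
  have hpp : p * p = p := by
    rw [hp, ← cfc_mul g g R gc.continuousOn gc.continuousOn]
    refine cfc_congr fun t ht => ?_
    rcases hspec t ht with rfl | h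
    · simp [g1]
    · simp [g0 t h]
  have hRp : R * p = c • p := by
    have h1 : R * p = cfc (fun t => t * g t) R := by
      rw [cfc_mul (fun t => t) g R continuousOn_id gc.continuousOn, cfc_id' ℝ R]
    rw [h1, hp, ← cfc_const_mul c g R gc.continuousOn]
    refine cfc_congr fun t ht => ?_
    rcases hspec t ht with rfl | h
    · simp
    · simp [g0 t h]
  have hsplit : R = cfc (fun t => t - c * g t) R + c • p := by
    rw [cfc_sub (fun t => t) (fun t => c * g t) R continuousOn_id (by fun_prop),
      cfc_id' ℝ R, cfc_const_mul c g R gc.continuousOn, sub_add_cancel]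
  have hnorm : ‖cfc (fun t => t - c * g t) R‖ ≤ r := by
    refine norm_cfc_le hr fun t ht => ?_
    rcases hspec t ht with rfl | h
    · simpa [g1] using hr
    · simpa [g0 t h] using h
  have hpw : p w = 0 := by
    have h1 : inner ℂ (p w) w = 0 := by
      refine hw _ ?_
      have := congrArg (fun T : H →L[ℂ] H => T w) hRp
      simpa using this
    have h2 : inner ℂ (p w) (p w) = inner ℂ (p w) w := by
      have h3 : inner ℂ (p (p w)) w = inner ℂ (p w) (p w) :=
        (ContinuousLinearMap.isSelfAdjoint_iff_isSymmetric.1 hpsa) (p w) w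
      have h4 : p (p w) = p w := congrArg (fun T : H →L[ℂ] H => T w) hpp
      rw [← h3, h4]
    rw [h1] at h2
    exact inner_self_eq_zero.1 h2
  have : R w = cfc (fun t => t - c * g t) R w := by
    conv_lhs => rw [hsplit]
    simp [hpw]
  rw [this]
  exact (ContinuousLinearMap.le_opNorm _ _).trans (by gcongr)

theorem mem_eigenspace_iff {M : H →ₗ.[ℂ] H} {lam : ℂ} {ψ : H} :
    ψ ∈ eigenspace M lam ↔ ∃ h : ψ ∈ M.domain, M ⟨ψ, h⟩ = lam • ψ := by
  simp only [eigenspace, Submodule.mem_map, LinearMap.mem_ker, LinearMap.sub_apply,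
    LinearMap.smul_apply, sub_eq_zero]
  constructor
  · rintro ⟨x, hx, rfl⟩
    exact ⟨x.2, hx⟩
  · rintro ⟨h, hx⟩
    exact ⟨⟨ψ, h⟩, hx, rfl⟩

/-- The resolvent identity, stated for one order of the factors. -/
theorem resolvent_identity {M : H →ₗ.[ℂ] H} {s z : ℂ} {R S : H →L[ℂ] H}
    (hR : ∀ x : M.domain, R (s • (x : H) - M x) = x)
    (hS : ∀ y : H, ∃ x : M.domain, (x : H) = S y ∧ z • (x : H) - M x = y) :
    S = R + (s - z) • (R * S) := by
  ext y
  obtain ⟨x, hx, hxy⟩ := hS y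
  have h := hR x
  have e : s • (x : H) - M x = y + (s - z) • (x : H) := by
    rw [← hxy]; module
  rw [e, map_add, map_smul, hx] at h
  simpa using h.symm

theorem notMem_spectrum_of_mem_resolventSet {M : H →ₗ.[ℂ] H} {s z : ℂ} {R : H →L[ℂ] H}
    (hR : ∀ x : M.domain, R (s • (x : H) - M x) = x)
    (hR' : ∀ y : H, ∃ x : M.domain, (x : H) = R y ∧ s • (x : H) - M x = y)
    (hz : z ∈ resolventSet M) (hsz : s ≠ z) : (s - z)⁻¹ ∉ spectrum ℂ R := by
  obtain ⟨S, hS, hS'⟩ := hz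
  have e1 := resolvent_identity hR hS'
  have e2 := resolvent_identity hS hR'
  have hd : s - z ≠ 0 := sub_ne_zero.2 hsz
  have k1 : (1 - (s - z) • R) * (1 + (s - z) • S) = 1 := by
    have : (1 - (s - z) • R) * (1 + (s - z) • S)
        = 1 + (s - z) • (S - (R + (s - z) • (R * S))) := by
      simp only [sub_mul, mul_add, one_mul, mul_one, smul_mul_assoc, mul_smul_comm, smul_sub,
        smul_add]
      abel
    rw [this, ← e1, sub_self, smul_zero, add_zero]
  have k2 : (1 + (s - z) • S) * (1 - (s - z) • R) = 1 := by
    have : (1 + (s - z) • S) * (1 - (s - z) • R)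
        = 1 - (s - z) • (R - (S + (z - s) • (S * R))) := by
      simp only [add_mul, mul_sub, one_mul, mul_one, smul_mul_assoc, mul_smul_comm, smul_sub,
        smul_add, smul_smul]
      module
    rw [this, ← e2, sub_self, smul_zero, sub_zero]
  rw [spectrum.notMem_iff]
  have hu : IsUnit (1 - (s - z) • R) := ⟨⟨_, _, k1, k2⟩, rfl⟩
  have : algebraMap ℂ (H →L[ℂ] H) (s - z)⁻¹ - R = (s - z)⁻¹ • (1 - (s - z) • R) := by
    rw [Algebra.algebraMap_eq_smul_one, smul_sub, smul_smul, inv_mul_cancel₀ hd, one_smul]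
  rw [this]
  exact (IsUnit.smul (Units.mk0 _ (inv_ne_zero hd)) hu)

theorem inner_apply_eq_of_isSelfAdjoint [CompleteSpace H] {M : H →ₗ.[ℂ] H}
    (hM : IsSelfAdjoint M) (x y : M.domain) : inner ℂ (M x) (y : H) = inner ℂ (x : H) (M y) := by
  have h := LinearPMap.adjoint_isFormalAdjoint hM.dense_domain
  rw [LinearPMap.isSelfAdjoint_def.1 hM] at h
  exact h x y

theorem conj_eq_of_mem_specDisc [CompleteSpace H] {M : H →ₗ.[ℂ] H} (hM : IsSelfAdjoint M)
    {lam : ℂ} (hlam : lam ∈ SpecDisc M) : (starRingEnd ℂ) lam = lam := by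
  obtain ⟨ψ, hψ, h0⟩ := Submodule.exists_mem_ne_zero_of_ne_bot hlam.2.2.1
  obtain ⟨hd, he⟩ := mem_eigenspace_iff.1 hψ
  have h := inner_apply_eq_of_isSelfAdjoint hM ⟨ψ, hd⟩ ⟨ψ, hd⟩
  rw [he, inner_smul_left, inner_smul_right] at h
  exact mul_right_cancel₀ (inner_self_ne_zero.2 h0) h

/-- On the orthogonal complement of the eigenspace, the distance from `lam` to the rest of the
spectrum bounds `M - lam` from below. A real point `s = lam + t` close to `lam` lies in the
resolvent set, the bounded operator `(s - M)⁻¹` has norm at most `(d - t)⁻¹` there, and `t → 0`. -/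
theorem spectralGap_mul_norm_le [CompleteSpace H] {M : H →ₗ.[ℂ] H} (hM : IsSelfAdjoint M)
    {lam : ℂ} (hlam : (starRingEnd ℂ) lam = lam) (hd : 0 < spectralGap M lam)
    (u : M.domain) (hu : (u : H) ∈ (eigenspace M lam)ᗮ) :
    spectralGap M lam * ‖(u : H)‖ ≤ ‖M u - lam • (u : H)‖ := by
  set d := spectralGap M lam with hd_def
  have hgap : ∀ x ∈ Spec M, x ≠ lam → d ≤ ‖x - lam‖ := fun x hx hne => by
    rw [← dist_eq_norm, dist_comm]
    exact Metric.infDist_le_dist_of_mem ⟨hx, hne⟩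
  have key : ∀ t : ℝ, 0 < t → t < d / 2 →
      (d - 2 * t) * ‖(u : H)‖ ≤ ‖M u - lam • (u : H)‖ := by
    intro t ht htd
    have hnt : ‖(t : ℂ)‖ = t := by simp [abs_of_pos ht]
    have ht0 : (t : ℂ) ≠ 0 := by exact_mod_cast ht.ne'
    have hs : lam + t ∈ resolventSet M := by
      by_contra hcon
      have := hgap (lam + t) hcon (by simpa using ht0)
      rw [add_sub_cancel_left, hnt] at this
      linarith
    obtain ⟨R, hR, hR'⟩ := hs
    have hconj : (starRingEnd ℂ) (lam + t) = lam + t := by simp [hlam]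
    have hRsa : IsSelfAdjoint R := by
      rw [ContinuousLinearMap.isSelfAdjoint_iff_isSymmetric]
      intro x y
      obtain ⟨a, ha, hax⟩ := hR' x
      obtain ⟨b, hb, hby⟩ := hR' y
      simp only [ContinuousLinearMap.coe_coe]
      rw [← ha, ← hb, ← hax, ← hby, inner_sub_left, inner_sub_right, inner_smul_left,
        inner_smul_right, hconj, inner_apply_eq_of_isSelfAdjoint hM]
    have hspec : ∀ τ ∈ spectrum ℝ R, τ = t⁻¹ ∨ |τ| ≤ (d - t)⁻¹ := by
      intro τ hτ
      rcases eq_or_ne τ 0 with rfl | h0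
      · right; simpa using by linarith
      have hτ' : (τ : ℂ) ∈ spectrum ℂ R := by
        have := spectrum.algebraMap_mem ℂ hτ
        simpa using this
      have hz : lam + t - (τ : ℂ)⁻¹ ∈ Spec M := by
        intro hcon
        refine notMem_spectrum_of_mem_resolventSet hR hR' hcon ?_ (by simpa using hτ')
        intro heq
        exact h0 (by simpa using (sub_eq_self.1 heq.symm))
      by_cases hl : lam + t - (τ : ℂ)⁻¹ = lam
      · left
        have : (t : ℂ) = (τ : ℂ)⁻¹ := by linear_combination hl
        have h2 : t = τ⁻¹ := by exact_mod_cast this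
        rw [h2, inv_inv]
      · right
        have h1 := hgap _ hz hl
        have h2 : ‖lam + t - (τ : ℂ)⁻¹ - lam‖ ≤ t + |τ|⁻¹ := by
          have : lam + t - (τ : ℂ)⁻¹ - lam = t - (τ : ℂ)⁻¹ := by ring
          rw [this]
          refine (norm_sub_le _ _).trans ?_
          simp [abs_of_pos ht]
        rw [← inv_inv |τ|]
        exact inv_anti₀ (by linarith) (by linarith)
    have hw := norm_apply_le_of_orthogonal_eigenspace hRsa (c := t⁻¹) (r := (d - t)⁻¹)
      (inv_nonneg.2 (by linarith))
      (by rw [abs_of_pos (inv_pos.2 ht)]; exact inv_strictAnti₀ ht (by linarith)) hspec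
      (w := (lam + t) • (u : H) - M u) (fun ψ hψ => by
        obtain ⟨a, ha, haψ⟩ := hR' ψ
        have hψa : ψ = (t : ℂ) • (a : H) := by
          rw [ha, hψ, smul_smul]
          simp [ht0]
        have hMψ : M a = lam • (a : H) := by
          have h3 : (lam + t) • (a : H) - M a = (t : ℂ) • (a : H) := haψ.trans hψa
          rw [add_smul] at h3
          have : M a = lam • (a : H) + (t : ℂ) • (a : H)
              - (lam • (a : H) + (t : ℂ) • (a : H) - M a) := by abel
          rw [this, h3]; abel
        have hau : inner ℂ (a : H) (u : H) = 0 :=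
          hu _ (mem_eigenspace_iff.2 ⟨a.2, hMψ⟩)
        rw [hψa, inner_smul_left, inner_sub_right, inner_smul_right, hau,
          ← inner_apply_eq_of_isSelfAdjoint hM, hMψ, inner_smul_left, hau]
        simp)
    rw [hR u] at hw
    have hdt : 0 < d - t := by linarith
    have h4 : (d - t) * ‖(u : H)‖ ≤ ‖(lam + t) • (u : H) - M u‖ := by
      rwa [← div_eq_inv_mul, le_div_iff₀ hdt, mul_comm] at hw
    have h5 : ‖(lam + t) • (u : H) - M u‖ ≤ t * ‖(u : H)‖ + ‖M u - lam • (u : H)‖ := by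
      have : (lam + t) • (u : H) - M u = (t : ℂ) • (u : H) - (M u - lam • (u : H)) := by module
      rw [this]
      refine (norm_sub_le _ _).trans ?_
      rw [norm_smul, hnt]
    linarith
  have hlim : Tendsto (fun t : ℝ => (d - 2 * t) * ‖(u : H)‖) (𝓝[>] 0) (𝓝 (d * ‖(u : H)‖)) := by
    have : Continuous fun t : ℝ => (d - 2 * t) * ‖(u : H)‖ := by fun_prop
    simpa using (this.tendsto 0).mono_left nhdsWithin_le_nhds
  refine le_of_tendsto hlim ?_
  filter_upwards [Ioo_mem_nhdsGT (half_pos hd)] with t ht using key t ht.1 ht.2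

/-! ### The quadratic polynomial as a sesquilinear form -/

theorem evalAt_quadPoly_apply (M : H →ₗ.[ℂ] H) (L : Submodule ℂ H) [FiniteDimensional ℂ L]
    (hL : L ≤ (sq M).domain) (z : ℂ) (u : L) :
    evalAt (quadPoly M L hL) z u = z ^ 2 • u
      - (2 * z) • compression M L (le_domain_of_le_sq_domain hL) u
      + compression (sq M) L hL u := by
  have h2 : (2 : L →L[ℂ] L) = algebraMap ℂ (L →L[ℂ] L) 2 := (map_ofNat _ 2).symm
  rw [evalAt, quadPoly, eval_add, eval_sub, eval_C, eval_mul_X, eval_C, ← one_mul (X ^ 2), eval_mul_X_pow,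
    eval_one, one_mul, h2,
    ← map_pow]
  simp [Algebra.algebraMap_eq_smul_one, smul_smul, mul_comm]

theorem inner_compression_right (T : H →ₗ.[ℂ] H) (L : Submodule ℂ H) [FiniteDimensional ℂ L]
    (h : L ≤ T.domain) (v u : L) :
    inner ℂ v (compression T L h u) = inner ℂ (v : H) (T ⟨u, h u.2⟩) :=
  L.inner_orthogonalProjectionOnto_eq_of_mem_left v _

/-- The compression `P(z)` of `(z - M)²` represents the form `⟪(z̄ - M) v, (z - M) u⟫` on `L`. -/
theorem inner_evalAt_quadPoly [CompleteSpace H] {M : H →ₗ.[ℂ] H} (hM : IsSelfAdjoint M)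
    (L : Submodule ℂ H) [FiniteDimensional ℂ L] (hL : L ≤ (sq M).domain) (z : ℂ) (v u : L) :
    inner ℂ v (evalAt (quadPoly M L hL) z u) =
      inner ℂ ((starRingEnd ℂ) z • (v : H) - M ⟨v, (hL v.2).1⟩)
        (z • (u : H) - M ⟨u, (hL u.2).1⟩) := by
  have h1 : (sq M) ⟨u, hL u.2⟩ = M ⟨M ⟨u, (hL u.2).1⟩, (hL u.2).2⟩ := rfl
  have h2 := inner_apply_eq_of_isSelfAdjoint hM ⟨v, (hL v.2).1⟩ ⟨M ⟨u, (hL u.2).1⟩, (hL u.2).2⟩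
  have h3 := inner_apply_eq_of_isSelfAdjoint hM ⟨v, (hL v.2).1⟩ ⟨u, (hL u.2).1⟩
  rw [evalAt_quadPoly_apply, inner_add_right, inner_sub_right, inner_smul_right, inner_smul_right,
    inner_compression_right, inner_compression_right, h1, ← h2, inner_sub_left, inner_sub_right,
    inner_sub_right, inner_smul_left, inner_smul_left, inner_smul_right, inner_smul_right, h3,
    Submodule.coe_inner, Complex.conj_conj]
  simp only
  ring

theorem inner_evalAt_quadPoly_conj [CompleteSpace H] {M : H →ₗ.[ℂ] H} (hM : IsSelfAdjoint M)
    (L : Submodule ℂ H) [FiniteDimensional ℂ L] (hL : L ≤ (sq M).domain) (z : ℂ) (v u : L) :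
    inner ℂ v (evalAt (quadPoly M L hL) z u) =
      inner ℂ (evalAt (quadPoly M L hL) ((starRingEnd ℂ) z) v) u := by
  rw [← inner_conj_symm _ u, inner_evalAt_quadPoly hM, inner_evalAt_quadPoly hM, inner_conj_symm,
    Complex.conj_conj]

/-- On the complement of the eigenspace the numerical range of `(z - M)²` stays in the half plane
`Re ≥ |z - lam|²` as long as `|z - lam|` is at most a quarter of the spectral gap. -/
theorem norm_sq_le_re_inner_of_mem_orthogonal [CompleteSpace H] {M : H →ₗ.[ℂ] H}
    (hM : IsSelfAdjoint M) {lam : ℂ} (hlam : (starRingEnd ℂ) lam = lam)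
    (hd : 0 < spectralGap M lam) {z : ℂ} (hz : ‖z - lam‖ ≤ spectralGap M lam / 4)
    (b : M.domain) (hb : (b : H) ∈ (eigenspace M lam)ᗮ) :
    ‖z - lam‖ ^ 2 * ‖(b : H)‖ ^ 2 ≤
      (inner ℂ ((starRingEnd ℂ) z • (b : H) - M b) (z • (b : H) - M b)).re := by
  have hg := spectralGap_mul_norm_le hM hlam hd b hb
  set d := spectralGap M lam
  set g : H := M b - lam • (b : H) with hgdef
  set ζ := z - lam with hζ
  have e1 : z • (b : H) - M b = ζ • (b : H) - g := by rw [hgdef, hζ]; module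
  have e2 : (starRingEnd ℂ) z • (b : H) - M b = (starRingEnd ℂ) ζ • (b : H) - g := by
    rw [hgdef, hζ, map_sub, hlam]; module
  have e3 : inner ℂ ((starRingEnd ℂ) z • (b : H) - M b) (z • (b : H) - M b) =
      ζ ^ 2 * (‖(b : H)‖ : ℂ) ^ 2 - ζ * inner ℂ (b : H) g - ζ * inner ℂ g (b : H)
        + ((‖g‖ ^ 2 : ℝ) : ℂ) := by
    clear_value g
    rw [e1, e2, inner_sub_left, inner_sub_right, inner_sub_right, inner_smul_left,
      inner_smul_left, inner_smul_right, inner_smul_right, Complex.conj_conj,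
      inner_self_eq_norm_sq_to_K, inner_self_eq_norm_sq_to_K]
    push_cast
    simp only [Complex.coe_algebraMap]
    ring
  have bd : ∀ w : ℂ, -‖w‖ ≤ w.re ∧ w.re ≤ ‖w‖ := fun w => abs_le.1 (Complex.abs_re_le_norm w)
  have b1 := (bd (ζ ^ 2 * (‖(b : H)‖ : ℂ) ^ 2)).1
  have b2 := (bd (ζ * inner ℂ (b : H) g)).2
  have b3 := (bd (ζ * inner ℂ g (b : H))).2
  have n1 : ‖ζ * inner ℂ (b : H) g‖ ≤ ‖ζ‖ * (‖(b : H)‖ * ‖g‖) := by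
    rw [norm_mul]; gcongr; exact norm_inner_le_norm _ _
  have n2 : ‖ζ * inner ℂ g (b : H)‖ ≤ ‖ζ‖ * (‖(b : H)‖ * ‖g‖) := by
    rw [norm_mul, mul_comm ‖(b : H)‖]; gcongr; exact norm_inner_le_norm _ _
  have n3 : ‖ζ ^ 2 * (‖(b : H)‖ : ℂ) ^ 2‖ = ‖ζ‖ ^ 2 * ‖(b : H)‖ ^ 2 := by simp
  rw [e3, Complex.add_re, Complex.sub_re, Complex.sub_re, Complex.ofReal_re]
  have hζ0 := norm_nonneg ζ
  have hb0 := norm_nonneg (b : H)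
  have hx : 4 * (‖ζ‖ * ‖(b : H)‖) ≤ ‖g‖ := by nlinarith
  have hy : 0 ≤ ‖ζ‖ * ‖(b : H)‖ := by positivity
  nlinarith

/-! ### The lower bound for the quadratic polynomial -/

/-- The lower bound for `P(z)` on the annulus. The test vector is `u` with its component in the
eigenspace rotated, and that component is then projected back into `L`; `η` measures the error
made by the projection. -/
theorem evalAt_quadPoly_lower_bound [CompleteSpace H] {M : H →ₗ.[ℂ] H} (hM : IsSelfAdjoint M)
    {lam : ℂ} (hlam : (starRingEnd ℂ) lam = lam) [FiniteDimensional ℂ (eigenspace M lam)]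
    (L : Submodule ℂ H) [FiniteDimensional ℂ L] (hL : L ≤ (sq M).domain)
    {z : ℂ} {δ η : ℝ} (hδ : 0 < δ) (hη0 : 0 ≤ η) (hδz : δ ≤ ‖z - lam‖)
    (hz : ‖z - lam‖ ≤ spectralGap M lam / 4)
    (hη : ∀ ψ ∈ eigenspace M lam,
      ‖(evalAt (quadPoly M L hL) ((starRingEnd ℂ) z) (L.orthogonalProjectionOnto ψ) : H)
        - ((starRingEnd ℂ) z - lam) ^ 2 • ψ‖ ≤ η * ‖ψ‖) (u : L) :
    (δ ^ 2 - 2 * η) / 3 * ‖u‖ ≤ ‖evalAt (quadPoly M L hL) z u‖ := by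
  set K := eigenspace M lam with hK
  have hd : 0 < spectralGap M lam := by linarith
  have haK : K.starProjection (u : H) ∈ K := K.starProjection_apply_mem _
  obtain ⟨had, hMa⟩ := mem_eigenspace_iff.1 haK
  have hbK : (u : H) - K.starProjection (u : H) ∈ Kᗮ := K.sub_starProjection_mem_orthogonal _
  have hbd : (u : H) - K.starProjection (u : H) ∈ M.domain := sub_mem (hL u.2).1 had
  set a : H := K.starProjection (u : H)
  set b : H := (u : H) - a with hb
  have hub : (u : H) = a + b := by rw [hb]; abel
  set ζ := z - lam with hζ
  have hζ0 : ζ ≠ 0 := norm_pos_iff.1 (hδ.trans_le hδz)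
  have hzc : (starRingEnd ℂ) z - lam = (starRingEnd ℂ) ζ := by rw [hζ, map_sub, hlam]
  have hab : inner ℂ a b = 0 := hbK a haK
  have hba : inner ℂ b a = 0 := inner_eq_zero_symm.1 hab
  have hpyth : ‖u‖ ^ 2 = ‖a‖ ^ 2 + ‖b‖ ^ 2 := by
    have h := norm_add_sq_eq_norm_sq_add_norm_sq_of_inner_eq_zero a b hab
    rw [← hub] at h
    simpa [pow_two] using h
  have hau : ‖a‖ ≤ ‖u‖ := K.norm_starProjection_apply_le _
  -- The form is diagonal with respect to the decomposition `u = a + b`.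
  have hform : inner ℂ u (evalAt (quadPoly M L hL) z u) = ζ ^ 2 * (‖a‖ : ℂ) ^ 2 +
      inner ℂ ((starRingEnd ℂ) z • b - M ⟨b, hbd⟩) (z • b - M ⟨b, hbd⟩) := by
    have hMu : M ⟨u, (hL u.2).1⟩ = lam • a + M ⟨b, hbd⟩ := by
      rw [← hMa, ← M.map_add]
      congr 1
      exact Subtype.ext hub
    have hMba : inner ℂ (M ⟨b, hbd⟩) a = 0 := by
      have := inner_apply_eq_of_isSelfAdjoint hM ⟨b, hbd⟩ ⟨a, had⟩
      rw [this, hMa, inner_smul_right]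
      exact mul_eq_zero_of_right _ hba
    have hMab : inner ℂ a (M ⟨b, hbd⟩) = 0 := inner_eq_zero_symm.1 hMba
    have e1 : z • (u : H) - M ⟨u, (hL u.2).1⟩ = ζ • a + (z • b - M ⟨b, hbd⟩) := by
      rw [hMu, hζ, hub]; module
    have e2 : (starRingEnd ℂ) z • (u : H) - M ⟨u, (hL u.2).1⟩ =
        (starRingEnd ℂ) ζ • a + ((starRingEnd ℂ) z • b - M ⟨b, hbd⟩) := by
      rw [hMu, ← hzc, hub]; module
    rw [inner_evalAt_quadPoly hM, e1, e2, inner_add_left, inner_add_right, inner_add_right]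
    have c1 : inner ℂ ((starRingEnd ℂ) ζ • a) (z • b - M ⟨b, hbd⟩) = 0 := by
      rw [inner_smul_left, inner_sub_right, inner_smul_right, hab, hMab]; simp
    have c2 : inner ℂ ((starRingEnd ℂ) z • b - M ⟨b, hbd⟩) (ζ • a) = 0 := by
      rw [inner_smul_right, inner_sub_left, inner_smul_left, hba, hMba]; simp
    rw [c1, c2, inner_smul_left, inner_smul_right, inner_self_eq_norm_sq_to_K, Complex.conj_conj]
    simp only [Complex.coe_algebraMap]
    ring
  have hre := norm_sq_le_re_inner_of_mem_orthogonal hM hlam hd hz ⟨b, hbd⟩ hbK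
  set B := inner ℂ ((starRingEnd ℂ) z • b - M ⟨b, hbd⟩) (z • b - M ⟨b, hbd⟩) with hB
  -- The value of the form at the projected eigenvector component, up to the error `r`.
  set p : L := L.orthogonalProjectionOnto a with hp
  set r : H := (evalAt (quadPoly M L hL) ((starRingEnd ℂ) z) p : H)
    - ((starRingEnd ℂ) z - lam) ^ 2 • a with hr
  have hrη : ‖r‖ ≤ η * ‖a‖ := hη a haK
  have hpform : inner ℂ p (evalAt (quadPoly M L hL) z u) =
      ζ ^ 2 * (‖a‖ : ℂ) ^ 2 + inner ℂ r (u : H) := by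
    have e : (evalAt (quadPoly M L hL) ((starRingEnd ℂ) z) p : H) =
        ((starRingEnd ℂ) ζ) ^ 2 • a + r := by rw [hr, hzc]; abel
    have hau' : inner ℂ a (u : H) = (‖a‖ : ℂ) ^ 2 := by
      rw [hub, inner_add_right, hab, add_zero, inner_self_eq_norm_sq_to_K]; simp
    rw [inner_evalAt_quadPoly_conj hM, Submodule.coe_inner, e, inner_add_left, inner_smul_left,
      hau', map_pow, Complex.conj_conj]
  -- Rotating the eigenvector component of the test vector turns `ζ ^ 2` into `|ζ| ^ 2`.
  set k : ℂ := (‖ζ‖ : ℂ) ^ 2 / ζ ^ 2 - 1 with hk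
  have hk2 : ‖k‖ ≤ 2 := by
    refine (norm_sub_le _ _).trans ?_
    have : ‖ζ‖ ≠ 0 := norm_ne_zero_iff.2 hζ0
    simp [this]
    norm_num
  have hkζ : ζ ^ 2 + k * ζ ^ 2 = (‖ζ‖ : ℂ) ^ 2 := by
    rw [hk]; field_simp; ring
  set v : L := u + (starRingEnd ℂ) k • p with hv
  have hpnorm : ‖p‖ ≤ ‖a‖ := L.norm_orthogonalProjectionOnto_apply_le a
  have hvnorm : ‖v‖ ≤ 3 * ‖u‖ := by
    refine (norm_add_le _ _).trans ?_
    rw [norm_smul, RCLike.norm_conj]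
    nlinarith [norm_nonneg k, norm_nonneg p, norm_nonneg u]
  have hvform : inner ℂ v (evalAt (quadPoly M L hL) z u) =
      ((‖ζ‖ ^ 2 * ‖a‖ ^ 2 : ℝ) : ℂ) + B + k * inner ℂ r (u : H) := by
    rw [hv, inner_add_left, inner_smul_left, hform, hpform, Complex.conj_conj]
    push_cast
    rw [← hkζ]
    ring
  have hkr : ‖k * inner ℂ r (u : H)‖ ≤ 2 * (η * ‖a‖ * ‖u‖) := by
    rw [norm_mul]
    have : ‖inner ℂ r (u : H)‖ ≤ ‖r‖ * ‖u‖ := norm_inner_le_norm _ _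
    have h2 : ‖r‖ * ‖u‖ ≤ η * ‖a‖ * ‖u‖ := by gcongr
    exact mul_le_mul hk2 (this.trans h2) (norm_nonneg _) (by norm_num)
  have hηu : 2 * (η * ‖a‖ * ‖u‖) ≤ ‖ζ‖ ^ 2 * ‖u‖ ^ 2 - (δ ^ 2 - 2 * η) * ‖u‖ ^ 2 := by
    have h1 : δ ^ 2 * ‖u‖ ^ 2 ≤ ‖ζ‖ ^ 2 * ‖u‖ ^ 2 := by gcongr
    have h2 : η * ‖a‖ * ‖u‖ ≤ η * ‖u‖ * ‖u‖ := by gcongr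
    linarith
  have h1 : (‖ζ‖ ^ 2 * ‖a‖ ^ 2 + B.re) - ‖k * inner ℂ r (u : H)‖ ≤
      ‖v‖ * ‖evalAt (quadPoly M L hL) z u‖ := by
    refine le_trans ?_ (norm_inner_le_norm (𝕜 := ℂ) _ _)
    refine le_trans ?_ (Complex.re_le_norm _)
    rw [hvform, Complex.add_re, Complex.add_re, Complex.ofReal_re]
    have := (abs_le.1 (Complex.abs_re_le_norm (k * inner ℂ r (u : H)))).1
    linarith
  have h2 : (δ ^ 2 - 2 * η) * ‖u‖ ^ 2 ≤ 3 * ‖u‖ * ‖evalAt (quadPoly M L hL) z u‖ := by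
    have h3 : ‖v‖ * ‖evalAt (quadPoly M L hL) z u‖ ≤
      3 * ‖u‖ * ‖evalAt (quadPoly M L hL) z u‖ := by gcongr
    have h4 : ‖ζ‖ ^ 2 * ‖u‖ ^ 2 = ‖ζ‖ ^ 2 * ‖a‖ ^ 2 + ‖ζ‖ ^ 2 * ‖b‖ ^ 2 := by
      rw [hpyth]; ring
    have hre' : ‖ζ‖ ^ 2 * ‖b‖ ^ 2 ≤ B.re := hre
    linarith
  rcases (norm_nonneg u).eq_or_lt with h0 | h0
  · rw [← h0]; simp
  · have : ‖u‖ * ((δ ^ 2 - 2 * η) * ‖u‖) ≤ ‖u‖ * (3 * ‖evalAt (quadPoly M L hL) z u‖) := by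
      linarith
    have := le_of_mul_le_mul_left this h0
    linarith

/-- Pointwise convergence to `0` on a finite-dimensional space is uniform on bounded sets. -/
theorem eventually_forall_norm_le_of_tendsto {K : Type*} [NormedAddCommGroup K] [NormedSpace ℂ K]
    [FiniteDimensional ℂ K] (T : ℕ → K →ₗ[ℂ] H)
    (hT : ∀ ψ, Tendsto (fun n => ‖T n ψ‖) atTop (𝓝 0)) {η : ℝ} (hη : 0 < η) :
    ∀ᶠ n in atTop, ∀ ψ, ‖T n ψ‖ ≤ η * ‖ψ‖ := by
  obtain ⟨C, hC, hbound⟩ := (Module.finBasis ℂ K).exists_opNorm_le (F := H)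
  have h : ∀ᶠ n in atTop, ∀ i, ‖T n (Module.finBasis ℂ K i)‖ ≤ η / C :=
    eventually_all.2 fun i => ((hT _).eventually_le_const (by positivity))
  filter_upwards [h] with n hn ψ
  have h1 := hbound (u := LinearMap.toContinuousLinearMap (T n)) (M := η / C) (by positivity) hn
  rw [mul_div_cancel₀ _ hC.ne'] at h1
  exact (LinearMap.toContinuousLinearMap (T n)).le_of_opNorm_le h1 ψ

/-- The approximation condition makes `P_n(z) Π_n ψ` close to `(z - lam)² ψ`, uniformly for
eigenvectors `ψ` and for bounded `z`. -/
theorem eventually_norm_evalAt_quadPoly_sub_le {M : H →ₗ.[ℂ] H} {lam : ℂ}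
    [FiniteDimensional ℂ (eigenspace M lam)]
    {L : ℕ → Submodule ℂ H} [∀ n, FiniteDimensional ℂ (L n)] {hL : ∀ n, L n ≤ (sq M).domain}
    (happ : ApproximatesEigenvectors M lam L hL) (ρ : ℝ) (hρ : 0 ≤ ρ) {η : ℝ} (hη : 0 < η) :
    ∀ᶠ n in atTop, ∀ ψ ∈ eigenspace M lam,
      ‖((L n).orthogonalProjectionOnto ψ : H) - ψ‖ ≤ η * ‖ψ‖ ∧ ∀ z : ℂ, ‖z‖ ≤ ρ →
      ‖(evalAt (quadPoly M (L n) (hL n)) z ((L n).orthogonalProjectionOnto ψ) : H)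
        - (z - lam) ^ 2 • ψ‖ ≤ η * ‖ψ‖ := by
  set K := eigenspace M lam
  set c := (ρ + 1) ^ 2
  have hc : 1 ≤ c := one_le_pow₀ (by linarith)
  have hηc : 0 < η / c := by positivity
  have hηle : η / c ≤ η := div_le_self hη.le hc
  let J : ∀ n, K →ₗ[ℂ] L n := fun n =>
    ((L n).orthogonalProjectionOnto : H →ₗ[ℂ] L n) ∘ₗ K.subtype
  have h0 := eventually_forall_norm_le_of_tendsto
    (fun n => (L n).subtype ∘ₗ J n - K.subtype) (fun ψ => (happ ψ ψ.2).1) hηc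
  have h1 := eventually_forall_norm_le_of_tendsto
    (fun n => (L n).subtype ∘ₗ (compression M (L n) (le_domain_of_le_sq_domain (hL n)) :
      L n →ₗ[ℂ] L n) ∘ₗ J n - lam • K.subtype) (fun ψ => (happ ψ ψ.2).2.1) hηc
  have h2 := eventually_forall_norm_le_of_tendsto
    (fun n => (L n).subtype ∘ₗ (compression (sq M) (L n) (hL n) :
      L n →ₗ[ℂ] L n) ∘ₗ J n - lam ^ 2 • K.subtype) (fun ψ => (happ ψ ψ.2).2.2) hηc
  filter_upwards [h0, h1, h2] with n h0 h1 h2 ψ hψ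
  have k0 : ‖((L n).orthogonalProjectionOnto ψ : H) - ψ‖ ≤ η / c * ‖ψ‖ := h0 ⟨ψ, hψ⟩
  have k1 : ‖(compression M (L n) (le_domain_of_le_sq_domain (hL n))
      ((L n).orthogonalProjectionOnto ψ) : H) - lam • ψ‖ ≤ η / c * ‖ψ‖ := h1 ⟨ψ, hψ⟩
  have k2 : ‖(compression (sq M) (L n) (hL n)
      ((L n).orthogonalProjectionOnto ψ) : H) - lam ^ 2 • ψ‖ ≤ η / c * ‖ψ‖ := h2 ⟨ψ, hψ⟩
  refine ⟨k0.trans (by gcongr), fun z hz => ?_⟩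
  set x := ((L n).orthogonalProjectionOnto ψ : H)
  set y := (compression M (L n) (le_domain_of_le_sq_domain (hL n))
      ((L n).orthogonalProjectionOnto ψ) : H)
  set w := (compression (sq M) (L n) (hL n) ((L n).orthogonalProjectionOnto ψ) : H)
  have e : (evalAt (quadPoly M (L n) (hL n)) z ((L n).orthogonalProjectionOnto ψ) : H)
      - (z - lam) ^ 2 • ψ = z ^ 2 • (x - ψ) - (2 * z) • (y - lam • ψ) + (w - lam ^ 2 • ψ) := by
    rw [evalAt_quadPoly_apply]
    simp only [Submodule.coe_add, Submodule.coe_sub, Submodule.coe_smul]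
    module
  rw [e]
  have t1 : ‖z ^ 2 • (x - ψ)‖ ≤ ρ ^ 2 * (η / c * ‖ψ‖) := by
    rw [norm_smul, norm_pow]; gcongr
  have t2 : ‖(2 * z) • (y - lam • ψ)‖ ≤ 2 * ρ * (η / c * ‖ψ‖) := by
    rw [norm_smul, norm_mul, Complex.norm_two]; gcongr
  have t3 := norm_add_le (z ^ 2 • (x - ψ) - (2 * z) • (y - lam • ψ)) (w - lam ^ 2 • ψ)
  have t4 := norm_sub_le (z ^ 2 • (x - ψ)) ((2 * z) • (y - lam • ψ))
  have t5 : ρ ^ 2 * (η / c * ‖ψ‖) + 2 * ρ * (η / c * ‖ψ‖) + η / c * ‖ψ‖ = η * ‖ψ‖ := by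
    have : ρ ^ 2 * (η / c * ‖ψ‖) + 2 * ρ * (η / c * ‖ψ‖) + η / c * ‖ψ‖ = c * (η / c) * ‖ψ‖ := by
      simp only [c]; ring
    rw [this, mul_div_cancel₀ _ (by positivity)]
  linarith

/-! ### Homotopy invariance of the number of roots in a disc -/

open Classical in
/-- The argument principle for a sum of simple fractions. -/
theorem circleIntegral_multiset_sum_one_div (c : ℂ) {R : ℝ} (hR : 0 < R) (s : Multiset ℂ)
    (hs : ∀ a ∈ s, ‖a - c‖ ≠ R) :
    CircleIntegrable (fun z => (s.map fun a => 1 / (z - a)).sum) c R ∧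
    (∮ z in C(c, R), (s.map fun a => 1 / (z - a)).sum) =
      2 * Real.pi * Complex.I * (s.countP fun a => ‖a - c‖ < R : ℕ) := by
  induction s using Multiset.induction_on with
  | empty => simp [circleIntegral]
  | cons a s ih =>
    obtain ⟨ih1, ih2⟩ := ih fun b hb => hs b (Multiset.mem_cons_of_mem hb)
    have ha : ‖a - c‖ ≠ R := hs a (Multiset.mem_cons_self a s)
    have hc : ∀ z, ‖z - c‖ ≠ ‖a - c‖ → ContinuousAt (fun z => 1 / (z - a)) z := fun z hz => by
      have : z - a ≠ 0 := fun h => hz (by rw [sub_eq_zero.1 h])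
      fun_prop (disch := assumption)
    have hi : CircleIntegrable (fun z => 1 / (z - a)) c R :=
      ContinuousOn.circleIntegrable hR.le fun z hz => (hc z (by
        rw [mem_sphere_iff_norm.1 hz]; exact ha.symm)).continuousWithinAt
    simp only [Multiset.map_cons, Multiset.sum_cons, Multiset.countP_cons]
    refine ⟨hi.add ih1, ?_⟩
    rw [circleIntegral.integral_add hi ih1, ih2]
    split_ifs with h
    · have := circleIntegral.integral_sub_inv_of_mem_ball (mem_ball_iff_norm.2 h)
      simp only [one_div]
      rw [this]
      push_cast
      ring
    · have h' : R < ‖a - c‖ := lt_of_le_of_ne (not_lt.1 h) ha.symm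
      have hne : ∀ z ∈ Metric.closedBall c R, ‖z - c‖ ≠ ‖a - c‖ := fun z hz =>
        ((mem_closedBall_iff_norm.1 hz).trans_lt h').ne
      rw [Complex.circleIntegral_eq_zero_of_differentiable_on_off_countable hR.le
        Set.countable_empty]
      · simp
      · exact fun z hz => (hc z (hne z hz)).continuousWithinAt
      · intro z hz
        have : z - a ≠ 0 := fun h => hne z (Metric.ball_subset_closedBall hz.1)
          (by rw [sub_eq_zero.1 h])
        fun_prop (disch := assumption)

open Classical in
/-- The argument principle for polynomials. -/
theorem circleIntegral_derivative_div_eval (p : ℂ[X]) (c : ℂ) {R : ℝ} (hR : 0 < R)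
    (hp : ∀ z, ‖z - c‖ = R → p.eval z ≠ 0) :
    (∮ z in C(c, R), p.derivative.eval z / p.eval z) =
      2 * Real.pi * Complex.I * (p.roots.countP fun a => ‖a - c‖ < R : ℕ) := by
  rw [← (circleIntegral_multiset_sum_one_div c hR p.roots
    fun a ha h => hp a h (isRoot_of_mem_roots ha)).2]
  refine circleIntegral.integral_congr hR.le fun z hz => ?_
  exact (IsAlgClosed.splits p).eval_derivative_div_eval_of_ne_zero
    (hp z (mem_sphere_iff_norm.1 hz))

theorem continuous_eval_eval_C (D : ℂ[X][X]) :
    Continuous fun x : ℂ × ℂ => (D.eval (C x.1)).eval x.2 := by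
  simp only [eval_eq_sum_range (p := D), eval_finsetSum, eval_mul, eval_pow, eval_C]
  exact continuous_finsetSum _ fun i _ =>
    ((D.coeff i).continuous.comp continuous_snd).mul (continuous_fst.pow i)

theorem continuous_eval_derivative_eval_C (D : ℂ[X][X]) :
    Continuous fun x : ℂ × ℂ => (D.eval (C x.1)).derivative.eval x.2 := by
  simp only [eval_eq_sum_range (p := D), derivative_sum, ← C_pow, derivative_mul, derivative_C,
    mul_zero, add_zero, eval_finsetSum, eval_mul, eval_C]
  exact continuous_finsetSum _ fun i _ =>
    ((D.coeff i).derivative.continuous.comp continuous_snd).mul (continuous_fst.pow i)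

open Classical in
/-- The number of roots in a disc is constant along a polynomial homotopy without zeros on the
boundary circle: by the argument principle it depends continuously on the parameter. -/
theorem countP_roots_eq_of_homotopy (D : ℂ[X][X]) (c : ℂ) {R : ℝ} (hR : 0 < R)
    (hD : ∀ t : ℝ, 0 ≤ t → t ≤ 1 → ∀ z, ‖z - c‖ = R → (D.eval (C (t : ℂ))).eval z ≠ 0) :
    (D.eval 1).roots.countP (fun a => ‖a - c‖ < R) =
      (D.eval 0).roots.countP (fun a => ‖a - c‖ < R) := by
  set N : unitInterval → ℕ := fun t =>
    (D.eval (C ((t : ℝ) : ℂ))).roots.countP fun a => ‖a - c‖ < R with hN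
  have hcirc : ∀ θ : ℝ, ‖circleMap c R θ - c‖ = R := fun θ =>
    mem_sphere_iff_norm.1 (circleMap_mem_sphere c hR.le θ)
  have hint : Continuous fun t : unitInterval => ∮ z in C(c, R),
      (D.eval (C ((t : ℝ) : ℂ))).derivative.eval z / (D.eval (C ((t : ℝ) : ℂ))).eval z := by
    refine intervalIntegral.continuous_parametric_intervalIntegral_of_continuous' ?_ _ _
    have hx : Continuous fun x : unitInterval × ℝ => (((x.1 : ℝ) : ℂ), circleMap c R x.2) := by
      fun_prop
    have h1 := (continuous_eval_derivative_eval_C D).comp hx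
    have h2 := (continuous_eval_eval_C D).comp hx
    have h3 : Continuous fun x : unitInterval × ℝ => deriv (circleMap c R) x.2 := by
      simp only [deriv_circleMap]; fun_prop
    exact h3.smul (h1.div h2 fun x => hD _ x.1.2.1 x.1.2.2 _ (hcirc _))
  have hval : ∀ t : unitInterval, (∮ z in C(c, R),
      (D.eval (C ((t : ℝ) : ℂ))).derivative.eval z / (D.eval (C ((t : ℝ) : ℂ))).eval z) =
        2 * Real.pi * Complex.I * (N t : ℂ) := fun t =>
    circleIntegral_derivative_div_eval _ c hR (hD _ t.2.1 t.2.2)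
  have hcont : Continuous N := by
    rw [Nat.isClosedEmbedding_coe_real.isInducing.continuous_iff]
    have h := Complex.continuous_re.comp (hint.div_const (2 * Real.pi * Complex.I))
    refine h.congr fun t => ?_
    simp only [Function.comp_apply, hval]
    rw [mul_div_cancel_left₀ _ Complex.two_pi_I_ne_zero]
    simp
  have := PreconnectedSpace.constant inferInstance hcont (x := 1) (y := 0)
  simpa [hN] using this

/-! ### Eigenvalues of operator polynomials -/

section OperatorPolynomials

variable {L : Type*} [NormedAddCommGroup L] [NormedSpace ℂ L]

theorem evalAt_add (P Q : (L →L[ℂ] L)[X]) (z : ℂ) :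
    evalAt (P + Q) z = evalAt P z + evalAt Q z := eval_add

theorem evalAt_C_algebraMap_mul (P : (L →L[ℂ] L)[X]) (t z : ℂ) :
    evalAt (C (algebraMap ℂ _ t) * P) z = t • evalAt P z := by
  rw [evalAt, eval_C_mul, ← Algebra.smul_def, evalAt]

theorem differentiable_evalAt (P : (L →L[ℂ] L)[X]) : Differentiable ℂ (evalAt P) := by
  have h : evalAt P = fun z => ∑ i ∈ Finset.range (P.natDegree + 1), z ^ i • P.coeff i := by
    ext1 z
    rw [evalAt, eval_eq_sum_range]
    refine Finset.sum_congr rfl fun i _ => ?_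
    rw [← map_pow, Algebra.smul_def, Algebra.commutes]
  rw [h]
  fun_prop

theorem norm_evalAt_linear_le (F G : L →L[ℂ] L) (z : ℂ) :
    ‖evalAt (C F * X - C G) z‖ ≤ ‖G‖ + ‖F‖ * ‖z‖ := by
  have h : evalAt (C F * X - C G) z = z • F - G := by
    rw [evalAt, eval_sub, eval_mul_X, eval_C, eval_C, ← Algebra.commutes, Algebra.smul_def]
  rw [h, add_comm, mul_comm, ← norm_smul]
  exact norm_sub_le _ _

variable [FiniteDimensional ℂ L]

theorem det_ne_zero_of_lower_bound {A : L →L[ℂ] L} {κ : ℝ} (hκ : 0 < κ)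
    (hA : ∀ u, κ * ‖u‖ ≤ ‖A u‖) : A.det ≠ 0 := by
  intro h
  obtain ⟨u, hu, hu0⟩ := Submodule.exists_mem_ne_zero_of_ne_bot
    (LinearMap.bot_lt_ker_of_det_eq_zero (f := (A : L →ₗ[ℂ] L)) h).ne'
  have h1 : A u = 0 := hu
  have h2 := hA u
  rw [h1, norm_zero] at h2
  exact (mul_pos hκ (norm_pos_iff.2 hu0)).not_ge h2

theorem isUnit_of_det_ne_zero {A : L →L[ℂ] L} (hA : A.det ≠ 0) : IsUnit A :=
  ⟨ContinuousLinearEquiv.toUnit (A.toContinuousLinearEquivOfDetNeZero hA), by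
    ext x; rfl⟩

/-- The determinant of `P + t Q` is a polynomial in `t` as well. -/
theorem exists_eval_C_eq_detPoly (P Q : (L →L[ℂ] L)[X]) :
    ∃ D : ℂ[X][X], ∀ t : ℂ, D.eval (C t) = detPoly (P + C (algebraMap ℂ _ t) * Q) := by
  set A := matPolyEquiv.symm (P.map (toMatrixHom L))
  set B := matPolyEquiv.symm (Q.map (toMatrixHom L)) with hB
  refine ⟨(A.map C + (X : ℂ[X][X]) • B.map C).det, fun t => ?_⟩
  have h1 : toMatrixHom L (algebraMap ℂ (L →L[ℂ] L) t) = algebraMap ℂ _ t :=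
    (LinearMap.toMatrixAlgEquiv (Module.finBasis ℂ L)).commutes t
  have h2 : matPolyEquiv.symm ((P + C (algebraMap ℂ (L →L[ℂ] L) t) * Q).map (toMatrixHom L)) =
      A + t • B := by
    rw [Polynomial.map_add, Polynomial.map_mul, map_C, h1, map_add, hB, ← map_smul]
    congr 2
    rw [Algebra.smul_def, Polynomial.algebraMap_apply]
  rw [detPoly, h2, ← coe_evalRingHom, RingHom.map_det]
  congr 1
  ext1 i j
  simp [smul_eq_C_mul, mul_comm (C t)]

/-- The number of eigenvalues in a disc does not change under a perturbation `Q` if no `P + t Q`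
with `0 ≤ t ≤ 1` is singular on the boundary circle. -/
theorem eigenvalueCount_add_eq (P Q : (L →L[ℂ] L)[X]) (c : ℂ) {R : ℝ} (hR : 0 < R)
    (h : ∀ t : ℝ, 0 ≤ t → t ≤ 1 → ∀ z, ‖z - c‖ = R →
      (evalAt P z + (t : ℂ) • evalAt Q z).det ≠ 0) :
    eigenvalueCount (P + Q) {z | ‖z - c‖ < R} = eigenvalueCount P {z | ‖z - c‖ < R} := by
  obtain ⟨D, hD⟩ := exists_eval_C_eq_detPoly P Q
  have h1 : D.eval 1 = detPoly (P + Q) := by simpa using hD 1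
  have h0 : D.eval 0 = detPoly P := by simpa using hD 0
  have key := countP_roots_eq_of_homotopy D c hR fun t ht0 ht1 z hz => by
    rw [hD, eval_detPoly, evalAt_add, evalAt_C_algebraMap_mul]
    exact h t ht0 ht1 z hz
  rw [h1, h0] at key
  simpa only [eigenvalueCount, Set.mem_ofPred_eq] using key

theorem eigenvalueCount_pos_iff {P : (L →L[ℂ] L)[X]} {S : Set ℂ} {z₀ : ℂ}
    (hz₀ : (evalAt P z₀).det ≠ 0) : 0 < eigenvalueCount P S ↔ (polySpec P ∩ S).Nonempty := by
  have hne : detPoly P ≠ 0 := fun h => hz₀ (by rw [← eval_detPoly, h, eval_zero])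
  classical
  rw [eigenvalueCount, Multiset.countP_pos]
  simp only [mem_roots hne, IsRoot.def, eval_detPoly]
  rfl

/-- If `P` is bounded below on a circle by a constant that fails as a lower bound at the centre,
then it has an eigenvalue inside: otherwise `z ↦ P(z)⁻¹ P(c) v` violates the maximum modulus
principle. -/
theorem polySpec_inter_ball_nonempty (P : (L →L[ℂ] L)[X]) (c : ℂ) {R κ : ℝ} (hR : 0 < R)
    (hκ : 0 < κ) (hP : ∀ z, ‖z - c‖ = R → ∀ u, κ * ‖u‖ ≤ ‖evalAt P z u‖) {v : L}
    (hv : ‖evalAt P c v‖ < κ * ‖v‖) : (polySpec P ∩ {z | ‖z - c‖ < R}).Nonempty := by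
  by_contra hcon
  have hunit : ∀ z ∈ Metric.closedBall c R, IsUnit (evalAt P z) := by
    intro z hz
    refine isUnit_of_det_ne_zero ?_
    rcases (mem_closedBall_iff_norm.1 hz).eq_or_lt with h | h
    · exact det_ne_zero_of_lower_bound hκ (hP z h)
    · exact fun h0 => hcon ⟨z, h0, h⟩
  have : CompleteSpace L := FiniteDimensional.complete ℂ L
  set f : ℂ → L := fun z => Ring.inverse (evalAt P z) (evalAt P c v)
  have hf : DifferentiableOn ℂ f (Metric.closedBall c R) := fun z hz => by
    have h1 : DifferentiableAt ℂ (fun z => Ring.inverse (evalAt P z)) z :=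
      (differentiableAt_inverse (𝕜 := ℂ) (hunit z hz)).comp z (differentiable_evalAt P z)
    exact (h1.clm_apply (differentiableAt_const _)).differentiableWithinAt
  have hbound := Complex.norm_le_of_forall_mem_frontier_norm_le (U := Metric.ball c R)
    Metric.isBounded_ball (f := f) (C := ‖evalAt P c v‖ / κ)
    (DifferentiableOn.diffContOnCl (by rwa [closure_ball c hR.ne']))
    (fun z hz => by
      rw [frontier_ball c hR.ne'] at hz
      have h1 := hP z (mem_sphere_iff_norm.1 hz) (f z)
      have h2 : evalAt P z (f z) = evalAt P c v := by
        have := Ring.mul_inverse_cancel _ (hunit z (Metric.sphere_subset_closedBall hz))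
        exact congrArg (fun T : L →L[ℂ] L => T (evalAt P c v)) this
      rw [h2] at h1
      rwa [le_div_iff₀ hκ, mul_comm])
    (subset_closure (Metric.mem_ball_self hR))
  have hfc : f c = v := by
    have := Ring.inverse_mul_cancel _ (hunit c (Metric.mem_closedBall_self hR.le))
    exact congrArg (fun T : L →L[ℂ] L => T v) this
  rw [hfc, le_div_iff₀ hκ] at hbound
  linarith

end OperatorPolynomials

end SecondOrderProjection

/-! ### Stability of the discrete eigenvalues under perturbation -/

theorem theorem2p2 {H : Type*} [NormedAddCommGroup H] [InnerProductSpace ℂ H] [CompleteSpace H]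
    (M : H →ₗ.[ℂ] H) (hM : IsSelfAdjoint M)
    (lam : ℂ) (hlam : lam ∈ SecondOrderProjection.SpecDisc M)
    (L : ℕ → Submodule ℂ H) [∀ n, FiniteDimensional ℂ (L n)]
    (hL : ∀ n, L n ≤ (SecondOrderProjection.sq M).domain)
    (happ : SecondOrderProjection.ApproximatesEigenvectors M lam L hL)
    (w₀ w₁ : ℝ) (hw₀ : 0 ≤ w₀) (hw₁ : 0 ≤ w₁) (hw : ¬ (w₀ = 0 ∧ w₁ = 0))
    (μ : ℝ) (hμ : μ = SecondOrderProjection.spectralGap M lam)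
    (δ : ℝ) (hδ : 0 < δ) (hδμ : δ < μ / 4) :
    ∃ N : ℕ, 0 < N ∧
      ∀ ε : ℝ, 0 ≤ ε →
        ε < δ ^ 2 * μ ^ 2 / (2 * (2 * δ ^ 2 + 3 * μ ^ 2) * (w₀ + w₁ * (μ / 4 + ‖lam‖))) →
      ∀ Q ∈ SecondOrderProjection.perturbations L ε w₀ w₁,
      ∀ n > N,
        SecondOrderProjection.polySpec (SecondOrderProjection.quadPoly M (L n) (hL n) + Q n) ∩
            {z | δ ≤ ‖z - lam‖ ∧ ‖z - lam‖ ≤ μ / 4} = ∅ ∧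
        (SecondOrderProjection.polySpec (SecondOrderProjection.quadPoly M (L n) (hL n) + Q n) ∩
            {z | ‖z - lam‖ < δ}).Nonempty ∧
        SecondOrderProjection.eigenvalueCount
            (SecondOrderProjection.quadPoly M (L n) (hL n) + Q n) {z | ‖z - lam‖ < δ} =
          SecondOrderProjection.eigenvalueCount
            (SecondOrderProjection.quadPoly M (L n) (hL n)) {z | ‖z - lam‖ < δ} := by
  have hμ0 : 0 < μ := by linarith
  have hreal := SecondOrderProjection.conj_eq_of_mem_specDisc hM hlam
  have hfin : FiniteDimensional ℂ (SecondOrderProjection.eigenspace M lam) := hlam.2.2.2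
  obtain ⟨ψ, hψ, hψ0⟩ := Submodule.exists_mem_ne_zero_of_ne_bot hlam.2.2.1
  have hψpos : 0 < ‖ψ‖ := norm_pos_iff.2 hψ0
  -- The smallness of `η` gives the lower bound `δ ^ 2 / 6` on the annulus, and an upper bound
  -- below it at `lam`.
  set η : ℝ := min (δ ^ 2 / 16) (1 / 4) with hη
  have hη0 : 0 < η := by positivity
  have hη1 : η ≤ δ ^ 2 / 16 := min_le_left _ _
  have hη2 : η ≤ 1 / 4 := min_le_right _ _
  obtain ⟨N, hN⟩ := eventually_atTop.1
    (SecondOrderProjection.eventually_norm_evalAt_quadPoly_sub_le happ (μ / 4 + ‖lam‖)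
      (by positivity) hη0)
  have hznorm : ∀ z : ℂ, ‖z - lam‖ ≤ μ / 4 → ‖z‖ ≤ μ / 4 + ‖lam‖ := fun z hz => by
    linarith [norm_sub_norm_le z lam]
  refine ⟨N + 1, N.succ_pos, fun ε hε0 hε Q hQ n hn => ?_⟩
  obtain ⟨F, G, hFG⟩ := hQ
  obtain ⟨hQn, hG, hF⟩ := hFG n
  have hNn := hN n (by omega)
  set P := SecondOrderProjection.quadPoly M (L n) (hL n) with hP
  set W := w₀ + w₁ * (μ / 4 + ‖lam‖) with hW
  have hWpos : 0 < W := by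
    have hr : 0 < μ / 4 + ‖lam‖ := by positivity
    rcases hw₀.eq_or_lt with h | h
    · have : 0 < w₁ := lt_of_le_of_ne hw₁ fun h' => hw ⟨h.symm, h'.symm⟩
      positivity
    · positivity
  -- The admissible bound `δ² μ² / (4 δ² + 6 μ²)` for `ε W` is at most `δ² / 6`.
  have hεW : ε * W < δ ^ 2 / 6 := by
    rw [← div_div, lt_div_iff₀ hWpos] at hε
    refine hε.trans_le ?_
    rw [div_le_div_iff₀ (by positivity) (by norm_num)]
    nlinarith [sq_nonneg (δ * δ)]
  have hPlow : ∀ z : ℂ, δ ≤ ‖z - lam‖ → ‖z - lam‖ ≤ μ / 4 → ∀ u,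
      δ ^ 2 / 6 * ‖u‖ ≤ ‖SecondOrderProjection.evalAt P z u‖ := fun z h1 h2 u => by
    refine le_trans ?_ (SecondOrderProjection.evalAt_quadPoly_lower_bound hM hreal (L n) (hL n)
      hδ hη0.le h1 (hμ ▸ h2)
      (fun ψ hψ => (hNn ψ hψ).2 _ (by rw [RCLike.norm_conj]; exact hznorm z h2)) u)
    exact mul_le_mul_of_nonneg_right (by linarith) (norm_nonneg u)
  have hQup : ∀ z : ℂ, ‖z - lam‖ ≤ μ / 4 → ∀ u,
      ‖SecondOrderProjection.evalAt (Q n) z u‖ ≤ ε * W * ‖u‖ := fun z h u => by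
    refine ContinuousLinearMap.le_of_opNorm_le _ ?_ u
    rw [hQn]
    refine (SecondOrderProjection.norm_evalAt_linear_le _ _ z).trans ?_
    have : ‖F n‖ * ‖z‖ ≤ w₁ * ε * (μ / 4 + ‖lam‖) :=
      mul_le_mul hF (hznorm z h) (norm_nonneg _) (by positivity)
    rw [hW]
    linarith
  have hdet : ∀ t : ℝ, 0 ≤ t → t ≤ 1 → ∀ z : ℂ, δ ≤ ‖z - lam‖ → ‖z - lam‖ ≤ μ / 4 →
      (SecondOrderProjection.evalAt P z
        + (t : ℂ) • SecondOrderProjection.evalAt (Q n) z).det ≠ 0 := by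
    intro t ht0 ht1 z h1 h2
    refine SecondOrderProjection.det_ne_zero_of_lower_bound (sub_pos.2 hεW) fun u => ?_
    have k1 := hPlow z h1 h2 u
    have k2 := hQup z h2 u
    have k3 : ‖(t : ℂ) • SecondOrderProjection.evalAt (Q n) z u‖ ≤ ε * W * ‖u‖ := by
      rw [norm_smul, Complex.norm_real, Real.norm_of_nonneg ht0]
      exact (mul_le_of_le_one_left (norm_nonneg _) ht1).trans k2
    have k4 := norm_sub_le_norm_add (SecondOrderProjection.evalAt P z u)
      ((t : ℂ) • SecondOrderProjection.evalAt (Q n) z u)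
    rw [add_apply, smul_apply]
    linarith
  have hdet1 : ∀ z : ℂ, δ ≤ ‖z - lam‖ → ‖z - lam‖ ≤ μ / 4 →
      (SecondOrderProjection.evalAt (P + Q n) z).det ≠ 0 := fun z h1 h2 => by
    have := hdet 1 zero_le_one le_rfl z h1 h2
    rwa [Complex.ofReal_one, one_smul, ← SecondOrderProjection.evalAt_add] at this
  have hcount := SecondOrderProjection.eigenvalueCount_add_eq P (Q n) lam hδ
    fun t ht0 ht1 z hz => hdet t ht0 ht1 z hz.ge (hz.le.trans hδμ.le)
  -- The point `lam + δ` lies on the circle, so that the determinants are not identically zero.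
  have hz₀ : ‖lam + δ - lam‖ = δ := by simp [abs_of_pos hδ]
  have hPne : (SecondOrderProjection.polySpec P ∩ {z | ‖z - lam‖ < δ}).Nonempty := by
    refine SecondOrderProjection.polySpec_inter_ball_nonempty P lam hδ (κ := δ ^ 2 / 6)
      (by positivity) (fun z hz => hPlow z hz.ge (hz.le.trans hδμ.le))
      (v := (L n).orthogonalProjectionOnto ψ) ?_
    obtain ⟨h1, h2⟩ := hNn ψ hψ
    have h3 : ‖SecondOrderProjection.evalAt P lam ((L n).orthogonalProjectionOnto ψ)‖
        ≤ η * ‖ψ‖ := by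
      simpa using h2 lam (by linarith)
    have h4 : 3 / 4 * ‖ψ‖ ≤ ‖(L n).orthogonalProjectionOnto ψ‖ := by
      have := norm_sub_norm_le ψ ((L n).orthogonalProjectionOnto ψ : H)
      rw [norm_sub_rev, ← Submodule.coe_norm] at this
      have h5 : η * ‖ψ‖ ≤ 1 / 4 * ‖ψ‖ := by gcongr
      linarith
    have hδ2 : 0 < δ ^ 2 * ‖ψ‖ := by positivity
    have h6 : η * ‖ψ‖ ≤ δ ^ 2 / 16 * ‖ψ‖ := by gcongr
    have h7 : δ ^ 2 / 6 * (3 / 4 * ‖ψ‖) ≤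
      δ ^ 2 / 6 * ‖(L n).orthogonalProjectionOnto ψ‖ := by gcongr
    linarith
  refine ⟨?_, ?_, hcount⟩
  · ext z
    simp only [Set.mem_inter_iff, Set.mem_ofPred_eq, Set.mem_empty_iff_false, iff_false]
    exact fun ⟨hz, h1, h2⟩ => hdet1 z h1 h2 hz
  · rw [← SecondOrderProjection.eigenvalueCount_pos_iff (hdet1 _ hz₀.ge (hz₀.le.trans hδμ.le)),
      hcount, SecondOrderProjection.eigenvalueCount_pos_iff (z₀ := lam + δ)]
    · exact hPne
    · exact SecondOrderProjection.det_ne_zero_of_lower_bound (κ := δ ^ 2 / 6) (by positivity)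
        (hPlow _ hz₀.ge (hz₀.le.trans hδμ.le))
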